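/- Let $\mathcal Z$ be a noetherian abelian category of homological dimension (at most) $2$, i.e. $\mathrm{Ext}^i_{\mathcal Z}(E,F)=0$ for all $E,F\in\mathcal Z$ and $i>2$. Let $T\in\mathcal Z$ be a tilting object with endomorphism ring $A=\mathrm{Hom}_{\mathcal Z}(T,T)$: $A$ is right noetherian, $\mathrm{Ext}^i_{\mathcal Z}(T,T)=0$ for $i\neq 0$, and the right derived functor $\Phi=R\mathrm{Hom}(T,-)$ exists on the bounded derived category and induces an equivalence of triangulated categories $\Phi: D^b(\mathcal Z)\to D^b(\mathrm{mod}\,A^{op})$, where $\mathrm{mod}\,A^{op}$ is the category of finitely generated right $A$-modules. Let $\Psi$ be a quasi-inverse of $\Phi$ and $\mathcal H=\Psi(\mathrm{mod}\,A^{op})\subseteq D^b(\mathcal Z)$. For $E \in \mathcal Z$ put $\Phi^i(E)=H^i(\Phi(E))$, and define full subcategories of $\mathcal Z$ by $$\mathcal B_i=\{E:\Phi^i(E)=0\},\qquad \mathcal X_i=\{E:\Phi^j(E)=0\ \text{for all } j\neq i\},\qquad \mathcal X_i^\circ=\{E:\mathrm{Hom}_{\mathcal Z}(G,E)=0\ \text{for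 all } G\in\mathcal X_i\}.$$ For a torsion pair $(\mathcal T,\mathcal F)$ in the heart of a bounded t-structure on $D^b(\mathcal Z)$, the tilt at $(\mathcal T,\mathcal F)$ is $\langle\mathcal F[1],\mathcal T\rangle$, the full subcategory of all $E$ that fit into a distinguished triangle $Y[1]\to E\to X\to Y[2]$ with $Y\in\mathcal F$ and $X\in\mathcal T$. Then: 1. $(\mathcal B_2,\ \mathcal B_0\cap\mathcal X_1^\circ)$ is a torsion pair in $\mathcal Z$, and the tilt $\mathcal U_{2,1}=\langle(\mathcal B_0\cap\mathcal X_1^\circ)[1],\mathcal B_2\rangle$ of $\mathcal Z$ at it is the heart of a bounded t-structure on $D^b(\mathcal Z)$; so is $\mathcal H$. 2. $(\mathcal U_{2,1}\cap\mathcal H,\ \mathcal U_{2,1}\cap\mathcal H[-1])$ is a torsion pair in $\mathcal U_{2,1}$, and $\mathcal H$ is the tilt of $\mathcal U_{2,1}$ at this torsion pair. -/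

import Mathlib

open CategoryTheory CategoryTheory.Limits CategoryTheory.Pretriangulated CategoryTheory.Triangulated

universe w₀ w₁ w₂ w₃ w v u

noncomputable section

namespace TiltingHearts

/-! ### Bounded complexes and bounded derived categories -/

section Bounded

variable (C : Type u) [Category.{v} C] [Abelian C]

/-- The bounded cochain complexes of objects of `C`. -/
def boundedComplex : ObjectProperty (CochainComplex C ℤ) :=
  fun K ↦ ∃ a b : ℤ, K.IsStrictlyGE a ∧ K.IsStrictlyLE b

variable [HasDerivedCategory.{w} C]

/-- The localization functor from bounded complexes to the bounded derived category. -/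
def boundedQ : (boundedComplex C).FullSubcategory ⥤ DerivedCategory.Bounded C :=
  ObjectProperty.lift _ ((boundedComplex C).ι ⋙ DerivedCategory.Q) (by
    rintro ⟨K, a, b, ha, hb⟩
    exact ⟨⟨a, ⟨K, Iso.refl _, ha⟩⟩, ⟨b, ⟨K, Iso.refl _, hb⟩⟩⟩)

/-- The embedding of `C` in its bounded derived category, as complexes concentrated in
degree `0`. -/
def boundedSingle : C ⥤ DerivedCategory.Bounded C :=
  ObjectProperty.lift _ (DerivedCategory.singleFunctor C 0)
    (fun _ ↦ ⟨⟨0, inferInstance⟩, ⟨0, inferInstance⟩⟩)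

/-- The cohomology functor `Hⁱ : Dᵇ(C) ⥤ C` of the standard t-structure. -/
def boundedHomology (i : ℤ) : DerivedCategory.Bounded C ⥤ C :=
  DerivedCategory.Bounded.ι ⋙ DerivedCategory.homologyFunctor C i

end Bounded

/-! ### Right derived functors -/

section Derived

variable {C : Type u} [Category.{v} C] [Abelian C] [HasDerivedCategory.{w} C]
  {E : Type*} [Category E]

/-- Let `F` be a functor on bounded complexes of objects of `C`.
`IsRightDerivedFunctor F R α` says that the right derived functor of `F` in the sense of
Deligne is defined on all of `Dᵇ(C)`, and that it is `R`, with the canonical transformation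
`α : F ⟶ R ∘ Q`: for every bounded complex `K`, the filtered system of the `F(K')`, indexed
by the quasi-isomorphisms `K ⟶ K'`, is essentially constant with value `R(Q K)`. Spelled out:
for some quasi-isomorphism `s : K ⟶ K'` there is `σ : R(Q K) ⟶ F(K')` which splits
`F(K') ⟶ R(Q K') ≅ R(Q K)` and through which `F(s)` factors. No injective objects are
needed; if `s : K ⟶ K'` is a bounded injective resolution, then `R(Q K) ≅ F(K')`. -/
def IsRightDerivedFunctor (F : (boundedComplex C).FullSubcategory ⥤ E)
    (R : DerivedCategory.Bounded C ⥤ E) (α : F ⟶ boundedQ C ⋙ R) : Prop :=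
  ∀ K : (boundedComplex C).FullSubcategory,
    ∃ (K' : (boundedComplex C).FullSubcategory) (s : K ⟶ K')
      (σ : R.obj ((boundedQ C).obj K) ⟶ F.obj K'),
      QuasiIso ((boundedComplex C).ι.map s) ∧
      α.app K ≫ σ = F.map s ∧ σ ≫ α.app K' = R.map ((boundedQ C).map s)

end Derived

/-! ### Torsion pairs and tilting -/

/-- `(𝒯, ℱ)` is a torsion pair in the abelian category `C`. -/
structure IsTorsionPair {C : Type u} [Category.{v} C] [Abelian C]
    (𝒯 ℱ : ObjectProperty C) : Prop where
  torsion_iso : 𝒯.IsClosedUnderIsomorphisms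
  torsionFree_iso : ℱ.IsClosedUnderIsomorphisms
  hom_eq_zero : ∀ ⦃X Y : C⦄ (f : X ⟶ Y), 𝒯 X → ℱ Y → f = 0
  exists_shortExact : ∀ E : C, ∃ S : ShortComplex C,
    S.ShortExact ∧ 𝒯 S.X₁ ∧ Nonempty (S.X₂ ≅ E) ∧ ℱ S.X₃

section Hearts

variable {D : Type u} [Category.{v} D] [Preadditive D] [HasZeroObject D] [HasShift D ℤ]
  [∀ n : ℤ, (shiftFunctor D n).Additive] [Pretriangulated D]

/-- `𝒰` is the heart of a bounded t-structure on the triangulated category `D`. -/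
def IsBoundedHeart (𝒰 : ObjectProperty D) : Prop :=
  ∃ t : TStructure D, t.heart = 𝒰 ∧ ∀ X : D, t.bounded X

/-- `(𝒯, ℱ)` is a torsion pair in the heart `𝒰` of a t-structure on `D`. The short exact
sequences of the abelian category `𝒰` are the distinguished triangles of `D` whose three
vertices lie in `𝒰`. -/
structure IsHeartTorsionPair (𝒰 𝒯 ℱ : ObjectProperty D) : Prop where
  torsion_le : 𝒯 ≤ 𝒰
  torsionFree_le : ℱ ≤ 𝒰
  torsion_iso : 𝒯.IsClosedUnderIsomorphisms
  torsionFree_iso : ℱ.IsClosedUnderIsomorphisms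
  hom_eq_zero : ∀ ⦃X Y : D⦄ (f : X ⟶ Y), 𝒯 X → ℱ Y → f = 0
  exists_triangle : ∀ E : D, 𝒰 E → ∃ (X Y : D) (f : X ⟶ E) (g : E ⟶ Y) (h : Y ⟶ X⟦(1 : ℤ)⟧),
    𝒯 X ∧ ℱ Y ∧ Triangle.mk f g h ∈ distTriang D

/-- The tilt of a heart at a torsion pair `(𝒯, ℱ)` in it: the full subcategory of `D` of the
objects `E` with `H⁻¹(E) ∈ ℱ`, `H⁰(E) ∈ 𝒯` and no other cohomology with respect to that heart,
that is, the extensions `Y[1] ⟶ E ⟶ X ⟶ Y[2]` with `Y ∈ ℱ` and `X ∈ 𝒯`. -/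
def tilt (𝒯 ℱ : ObjectProperty D) : ObjectProperty D :=
  fun E ↦ ∃ (X Y : D) (f : Y⟦(1 : ℤ)⟧ ⟶ E) (g : E ⟶ X) (h : X ⟶ (Y⟦(1 : ℤ)⟧)⟦(1 : ℤ)⟧),
    𝒯 X ∧ ℱ Y ∧ Triangle.mk f g h ∈ distTriang D

/-- The heart `𝒱` is obtained from the heart `𝒰` by tilting at the torsion pair `(𝒯, ℱ)`
in `𝒰`. -/
structure IsTiltAt (𝒰 𝒯 ℱ 𝒱 : ObjectProperty D) : Prop where
  torsionPair : IsHeartTorsionPair 𝒰 𝒯 ℱ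
  eq_tilt : 𝒱 = tilt 𝒯 ℱ

end Hearts

/-! ### Tilting objects -/

section Tilting

variable {Z : Type u} [Category.{v} Z] [Abelian Z]

variable (Z) in
/-- `Z` is a noetherian abelian category. -/
def IsNoetherianCategory : Prop := ∀ E : Z, IsNoetherianObject E

variable (Z) in
/-- `Z` has homological dimension (at most) `n`: all `Extⁱ` with `i > n` vanish. -/
def HasHomologicalDimension [HasExt.{w₀} Z] (n : ℕ) : Prop :=
  ∀ (E F : Z) (i : ℕ), n < i → Subsingleton (Abelian.Ext.{w₀} E F i)

/-- The ring `Aᵒᵖ` for `A = Hom(T, T)`; left modules over it are right `A`-modules. -/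
abbrev EndOp (T : Z) : Type v := (End T)ᵐᵒᵖ

/-- The functor `Hom(T, -)` on bounded complexes, with values in the derived category of all
right modules over `A = Hom(T, T)`. -/
def homComplex (T : Z) [HasDerivedCategory.{w₃} (ModuleCat.{v} (EndOp T))] :
    (boundedComplex Z).FullSubcategory ⥤ DerivedCategory (ModuleCat.{v} (EndOp T)) :=
  (boundedComplex Z).ι ⋙
    (preadditiveCoyonedaObj T).mapHomologicalComplex (ComplexShape.up ℤ) ⋙ DerivedCategory.Q

instance forgetAdditive (R : Type v) [Ring R] :
    (forget₂ (FGModuleCat.{v} R) (ModuleCat.{v} R)).Additive where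

/-- The functor `Dᵇ(mod R) ⥤ D(Mod R)` induced by the inclusion of the finitely generated
modules in all modules over the noetherian ring `R`. -/
def boundedToModule (R : Type v) [Ring R] [IsNoetherianRing R]
    [HasDerivedCategory.{w₂} (FGModuleCat.{v} R)] [HasDerivedCategory.{w₃} (ModuleCat.{v} R)] :
    DerivedCategory.Bounded (FGModuleCat.{v} R) ⥤ DerivedCategory (ModuleCat.{v} R) :=
  DerivedCategory.Bounded.ι ⋙
    (forget₂ (FGModuleCat.{v} R) (ModuleCat.{v} R)).mapDerivedCategory

variable [HasExt.{w₀} Z] [HasDerivedCategory.{w₁} Z]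

/-- The tilting structure of an object `T` of `Z`: `Extⁱ(T, T) = 0` for `i ≠ 0`, and the right derived functor
`Φ = RHom(T, -)` is defined on `Dᵇ(Z)` and induces an equivalence of triangulated categories
from `Dᵇ(Z)` to `Dᵇ(mod Aᵒᵖ)`. Here `A = Hom(T, T)` and `mod Aᵒᵖ` is the category of finitely
generated right `A`-modules, which is abelian as `A` is right noetherian. -/
structure TiltingEquivalence (T : Z) [IsNoetherianRing (EndOp T)]
    [HasDerivedCategory.{w₂} (FGModuleCat.{v} (EndOp T))]
    [HasDerivedCategory.{w₃} (ModuleCat.{v} (EndOp T))] where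
  /-- `Extⁱ(T, T) = 0` for `i ≠ 0`. -/
  ext_self : ∀ i : ℕ, i ≠ 0 → Subsingleton (Abelian.Ext.{w₀} T T i)
  /-- The equivalence `Φ`, with its quasi-inverse `Ψ = equiv.inverse`. -/
  equiv : DerivedCategory.Bounded Z ≌ DerivedCategory.Bounded (FGModuleCat.{v} (EndOp T))
  /-- `Φ` commutes with the shifts. -/
  [commShift : equiv.functor.CommShift ℤ]
  isTriangulated : equiv.functor.IsTriangulated
  /-- The canonical transformation `Hom(T, K) ⟶ Φ(K)`. -/
  unit : homComplex T ⟶ boundedQ Z ⋙ equiv.functor ⋙ boundedToModule (EndOp T)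
  isRightDerivedFunctor : IsRightDerivedFunctor (homComplex T)
    (equiv.functor ⋙ boundedToModule (EndOp T)) unit

namespace TiltingEquivalence

variable {T : Z} [IsNoetherianRing (EndOp T)]
  [HasDerivedCategory.{w₂} (FGModuleCat.{v} (EndOp T))]
  [HasDerivedCategory.{w₃} (ModuleCat.{v} (EndOp T))]
  (Φ : TiltingEquivalence.{w₀, w₁, w₂, w₃} T)

/-- `Φⁱ(E) = Hⁱ(Φ(E))`, an object of `mod Aᵒᵖ`, for `E` in `Z`. -/
def coh (i : ℤ) (E : Z) : FGModuleCat.{v} (EndOp T) :=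
  (boundedHomology _ i).obj (Φ.equiv.functor.obj ((boundedSingle Z).obj E))

/-- `ℬᵢ`, the objects `E` of `Z` with `Φⁱ(E) = 0`. -/
def B (i : ℤ) : ObjectProperty Z := fun E ↦ IsZero (Φ.coh i E)

/-- `𝒳ᵢ`, the objects `E` of `Z` with `Φʲ(E) = 0` for all `j ≠ i`. -/
def X (i : ℤ) : ObjectProperty Z := fun E ↦ ∀ j : ℤ, j ≠ i → IsZero (Φ.coh j E)

/-- `ℋ = Ψ(mod Aᵒᵖ)`, a full subcategory of `Dᵇ(Z)` closed under isomorphisms. -/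
def H : ObjectProperty (DerivedCategory.Bounded Z) :=
  (boundedSingle (FGModuleCat.{v} (EndOp T)) ⋙ Φ.equiv.inverse).essImage

/-- `𝒰₂₁`, the tilt of `Z` (the standard heart of `Dᵇ(Z)`) at the pair
`(ℬ₂, ℬ₀ ∩ 𝒳₁°)`. -/
def U21 : ObjectProperty (DerivedCategory.Bounded Z) :=
  tilt ((Φ.B 2).map (boundedSingle Z)) ((Φ.B 0 ⊓ (Φ.X 1).rightOrthogonal).map (boundedSingle Z))

end TiltingEquivalence

end Tilting

end TiltingHearts

end

/-! Compare t-structures on `Dᵇ(Z)`: the standard one, its tilt `s` with heart `𝒰₂₁`, and the one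
pulled back along `Φ`, with heart `ℋ` (degrees for it are called `Φ`-degrees). Homological dimension
2 gives `Φⁱ(E) = 0` for `i` outside `0, 1, 2` (`isZero_coh`). Dévissage along standard truncations
then puts standard degrees `≤ n` into `Φ`-degrees `≤ n + 2`, and standard degrees `≥ n` into
`Φ`-degrees `≥ n`.

As `Φ³ = 0`, the functor `Φ²` is right exact, so `ℬ₂` is closed under quotients and extensions. In a
noetherian category it is therefore a torsion class (`isTorsionPair_rightOrthogonal`). Its right
orthogonal is `ℬ₀ ∩ 𝒳₁°` (`rightOrthogonal_B_two`): one inclusion uses the `Φ`-truncation of an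
object, the other the image of a map.

The tilt has aisle `D^{≤ -1} * ℬ₂`, which lies in `Φ`-degrees `≤ 1`. Conversely, an object of
`Φ`-degrees `≤ 0` lies in standard degrees `≤ 0` and has no maps to the torsion-free part, which has
`Φ`-degrees `≥ 1`. So the aisle of `Φ` lies between that of `s` and its shift by 1, and any
t-structure in this position is a tilt of `s` (`isTiltAt_of_isLE`). -/

noncomputable section

namespace TiltingHearts

/-! ### Truncation estimates in distinguished triangles. -/

section TStructures

variable {D : Type u} [Category.{v} D] [Preadditive D] [HasShift D ℤ]
  [∀ n : ℤ, (shiftFunctor D n).Additive]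

lemma isZero_of_isZero_shift {X : D} {n : ℤ} (h : IsZero (X⟦n⟧)) : IsZero X :=
  (((shiftFunctor D (-n)).map_isZero h)).of_iso ((shiftEquiv D n).unitIso.app X)

variable [HasZeroObject D] [Pretriangulated D]

variable {A X B : D} {f : A ⟶ X} {g : X ⟶ B} {k : B ⟶ A⟦(1 : ℤ)⟧}

lemma exists_desc_of_distTriang (hT : Triangle.mk f g k ∈ distTriang D) {Y : D} (φ : X ⟶ Y)
    (hφ : f ≫ φ = 0) : ∃ ψ : B ⟶ Y, φ = g ≫ ψ :=
  Triangle.yoneda_exact₂ _ hT φ hφ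

lemma exists_lift_of_distTriang (hT : Triangle.mk f g k ∈ distTriang D) {Y : D} (φ : Y ⟶ X)
    (hφ : φ ≫ g = 0) : ∃ ψ : Y ⟶ A, φ = ψ ≫ f :=
  Triangle.coyoneda_exact₂ _ hT φ hφ

lemma distTriang_trunc (t : TStructure D) (n : ℤ) (X : D) :
    Triangle.mk ((t.truncLTι n).app X) ((t.truncGEπ n).app X) ((t.truncGEδLT n).app X) ∈
      distTriang D :=
  t.triangleLTGE_distinguished n X

/-- When `f = 0`, the identity of `A⟦1⟧` factors through a map from `A⟦1⟧` (degrees `≤ n - 1`) to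
`B` (degrees `≥ n`), which vanishes. -/
lemma isZero_left_of_eq_zero (hT : Triangle.mk f g k ∈ distTriang D) (t : TStructure D) (n : ℤ)
    (h₁ : t.IsLE A n) (h₃ : t.IsGE B n) (h : f = 0) : IsZero A := by
  have := t.isLE_shift A n 1 (n - 1)
  obtain ⟨p, hp⟩ : ∃ p : A⟦(1 : ℤ)⟧ ⟶ B, 𝟙 _ = p ≫ k :=
    Triangle.coyoneda_exact₁ _ hT (𝟙 (A⟦(1 : ℤ)⟧)) (by
      change _ ≫ f⟦(1 : ℤ)⟧' = 0
      rw [h, Functor.map_zero, comp_zero])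
  rw [t.zero p (n - 1) n, zero_comp] at hp
  exact isZero_of_isZero_shift ((IsZero.iff_id_eq_zero _).2 hp)

lemma isZero_right_of_eq_zero (hT : Triangle.mk f g k ∈ distTriang D) (t : TStructure D) (n : ℤ)
    (h₁ : t.IsLE A n) (h₃ : t.IsGE B n) (h : g = 0) : IsZero B := by
  have := t.isLE_shift A n 1 (n - 1)
  obtain ⟨p, hp⟩ : ∃ p : A⟦(1 : ℤ)⟧ ⟶ B, 𝟙 B = k ≫ p :=
    Triangle.yoneda_exact₃ _ hT (𝟙 B) (by
      change g ≫ _ = 0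
      rw [h, zero_comp])
  rw [t.zero p (n - 1) n, comp_zero] at hp
  exact (IsZero.iff_id_eq_zero _).2 hp

lemma isLE_right_of_distTriang (hT : Triangle.mk f g k ∈ distTriang D) (t : TStructure D) (n : ℤ)
    (h₁ : t.IsLE A (n + 1)) (h₂ : t.IsLE X n) : t.IsLE B n :=
  t.isLE₂ _ (rot_of_distTriang _ hT) n h₂ (t.isLE_shift A (n + 1) 1 n)

lemma isGE_left_of_distTriang (hT : Triangle.mk f g k ∈ distTriang D) (t : TStructure D) (n : ℤ)
    (h₂ : t.IsGE X n) (h₃ : t.IsGE B (n - 1)) : t.IsGE A n :=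
  t.isGE₂ _ (inv_rot_of_distTriang _ hT) n (t.isGE_shift B (n - 1) (-1) n) h₂

/-- In this form the first vertex need not be presented as a shift, so truncation triangles serve
directly as witnesses. -/
lemma tilt_eq_extensionProduct (𝒯 ℱ : ObjectProperty D) [ℱ.IsClosedUnderIsomorphisms] :
    tilt 𝒯 ℱ = ObjectProperty.extensionProduct (ℱ.shift (-1 : ℤ)) 𝒯 := by
  ext E
  constructor
  · rintro ⟨X, Y, f, g, h, hX, hY, hT⟩
    exact ⟨Y⟦(1 : ℤ)⟧, X, f, g, h, hT,
      ℱ.prop_of_iso ((shiftEquiv D (1 : ℤ)).unitIso.app Y) hY, hX⟩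
  · rintro ⟨A, X, f, g, h, hT, hA, hX⟩
    let e : (A⟦(-1 : ℤ)⟧)⟦(1 : ℤ)⟧ ≅ A := (shiftEquiv D (1 : ℤ)).counitIso.app A
    refine ⟨X, A⟦(-1 : ℤ)⟧, e.hom ≫ f, g, h ≫ e.inv⟦(1 : ℤ)⟧', hX, hA,
      isomorphic_distinguished _ hT _ (Triangle.isoMk _ _ e (Iso.refl _) (Iso.refl _)
        (Category.comp_id _) ((Category.comp_id _).trans (Category.id_comp _).symm) ?_)⟩
    change (h ≫ e.inv⟦(1 : ℤ)⟧') ≫ e.hom⟦(1 : ℤ)⟧' = 𝟙 X ≫ h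
    simp [← Functor.map_comp]

end TStructures

/-! ### The t-structure obtained by tilting at a torsion pair (Happel–Reiten–Smalø). -/

section TiltedTStructure

variable {D : Type u} [Category.{v} D] [Preadditive D] [HasZeroObject D] [HasShift D ℤ]
  [∀ n : ℤ, (shiftFunctor D n).Additive] [Pretriangulated D]
  {t : TStructure D} {𝒯 ℱ : ObjectProperty D}

lemma IsHeartTorsionPair.torsionFree_of_rightOrthogonal (h : IsHeartTorsionPair t.heart 𝒯 ℱ)
    {E : D} (hE : t.heart E) (hE' : 𝒯.rightOrthogonal E) : ℱ E := by
  obtain ⟨X, Y, f, g, k, hX, hY, hT⟩ := h.exists_triangle E hE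
  have := isZero_left_of_eq_zero hT t 0 ⟨(h.torsion_le _ hX).1⟩
    ⟨(h.torsionFree_le _ hY).2⟩ (hE' f hX)
  have : IsIso g := (Triangle.isZero₁_iff_isIso₂ _ hT).1 this
  have := h.torsionFree_iso
  exact ℱ.prop_of_iso (asIso g).symm hY

lemma IsHeartTorsionPair.torsion_of_leftOrthogonal (h : IsHeartTorsionPair t.heart 𝒯 ℱ)
    {E : D} (hE : t.heart E) (hE' : ℱ.leftOrthogonal E) : 𝒯 E := by
  obtain ⟨X, Y, f, g, k, hX, hY, hT⟩ := h.exists_triangle E hE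
  have := isZero_right_of_eq_zero hT t 0 ⟨(h.torsion_le _ hX).1⟩
    ⟨(h.torsionFree_le _ hY).2⟩ (hE' g hY)
  have : IsIso f := (Triangle.isZero₃_iff_isIso₁ _ hT).1 this
  have := h.torsion_iso
  exact 𝒯.prop_of_iso (asIso f) hX

variable (t) in
/-- The aisle of the tilt at the torsion pair with torsion-free part `ℱ`. -/
def tiltLE (ℱ : ObjectProperty D) : ObjectProperty D := t.le 0 ⊓ ℱ.leftOrthogonal

variable (t) in
/-- The coaisle, in degrees `≥ 1`, of the tilt at the torsion pair with torsion part `𝒯`. -/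
def tiltGE (𝒯 : ObjectProperty D) : ObjectProperty D := t.ge 0 ⊓ 𝒯.rightOrthogonal

instance (ℱ : ObjectProperty D) : (tiltLE t ℱ).IsClosedUnderIsomorphisms := by
  unfold tiltLE; infer_instance

instance (𝒯 : ObjectProperty D) : (tiltGE t 𝒯).IsClosedUnderIsomorphisms := by
  unfold tiltGE; infer_instance

lemma IsHeartTorsionPair.tiltLE_of_isLE (h : IsHeartTorsionPair t.heart 𝒯 ℱ) (X : D)
    [t.IsLE X (-1)] : tiltLE t ℱ X :=
  ⟨(t.isLE_of_le X (-1) 0).le, fun _ f hY ↦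
    have : t.IsGE _ 0 := ⟨(h.torsionFree_le _ hY).2⟩
    t.zero f (-1) 0⟩

lemma IsHeartTorsionPair.tiltGE_of_isGE (h : IsHeartTorsionPair t.heart 𝒯 ℱ) (X : D)
    [t.IsGE X 1] : tiltGE t 𝒯 X :=
  ⟨(t.isGE_of_ge X 0 1).ge, fun _ f hY ↦
    have : t.IsLE _ 0 := ⟨(h.torsion_le _ hY).1⟩
    t.zero f 0 1⟩

/-- For `X` in degrees `≤ 0`, this truncation is `H⁰(X)`. Its maps to `ℱ` are determined by their
composites with `X ⟶ H⁰(X)`, which vanish. -/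
lemma IsHeartTorsionPair.truncGE_of_tiltLE [IsTriangulated D]
    (h : IsHeartTorsionPair t.heart 𝒯 ℱ) {X : D}
    (hX : tiltLE t ℱ X) : 𝒯 ((t.truncGE 0).obj X) := by
  have : t.IsLE X 0 := ⟨hX.1⟩
  refine h.torsion_of_leftOrthogonal ⟨t.le_of_isLE _ _, t.ge_of_isGE _ _⟩ (fun Y f hY ↦ ?_)
  have : t.IsGE Y 0 := ⟨(h.torsionFree_le _ hY).2⟩
  exact t.from_truncGE_obj_ext (by rw [comp_zero]; exact hX.2 _ hY)

lemma IsHeartTorsionPair.tilt_zero [IsTriangulated D] (h : IsHeartTorsionPair t.heart 𝒯 ℱ)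
    {X Y : D} (f : X ⟶ Y) (hX : tiltLE t ℱ X) (hY : tiltGE t 𝒯 Y) : f = 0 := by
  have : t.IsGE Y 0 := ⟨hY.1⟩
  rw [← t.π_descTruncGE f 0, hY.2 (t.descTruncGE f 0) (h.truncGE_of_tiltLE hX), comp_zero]

/-- Every object lies in `D^{≤ -1} * (𝒯 * ℱ) * D^{≥ 1}`. Associativity regroups this as `(D^{≤ -1} *
𝒯) * (ℱ * D^{≥ 1})`, whose factors lie in the new aisle and coaisle. -/
lemma IsHeartTorsionPair.exists_tilt_triangle [IsTriangulated D]
    (h : IsHeartTorsionPair t.heart 𝒯 ℱ) (E : D) :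
    (tiltLE t ℱ).extensionProduct (tiltGE t 𝒯) E := by
  have h₁ : (t.le (-1)).extensionProduct 𝒯 ≤ tiltLE t ℱ := by
    rintro X ⟨A, B, f, g, k, hT, hA, hB⟩
    have : t.IsLE A (-1) := ⟨hA⟩
    refine ⟨(t.isLE₂ _ hT 0 (t.isLE_of_le A (-1) 0) ⟨(h.torsion_le _ hB).1⟩).le,
      fun Y φ hY ↦ ?_⟩
    have : t.IsGE Y 0 := ⟨(h.torsionFree_le _ hY).2⟩
    obtain ⟨ψ, rfl⟩ := exists_desc_of_distTriang hT φ (t.zero (f ≫ φ) (-1) 0)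
    rw [h.hom_eq_zero ψ hB hY, comp_zero]
  have h₂ : ℱ.extensionProduct (t.ge 1) ≤ tiltGE t 𝒯 := by
    rintro X ⟨A, B, f, g, k, hT, hA, hB⟩
    have : t.IsGE B 1 := ⟨hB⟩
    refine ⟨(t.isGE₂ _ hT 0 ⟨(h.torsionFree_le _ hA).2⟩ (t.isGE_of_ge B 0 1)).ge,
      fun Y φ hY ↦ ?_⟩
    have : t.IsLE Y 0 := ⟨(h.torsion_le _ hY).1⟩
    obtain ⟨ψ, rfl⟩ := exists_lift_of_distTriang hT φ (t.zero (φ ≫ g) 0 1)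
    rw [h.hom_eq_zero ψ hY hA, zero_comp]
  refine ObjectProperty.monotone_extensionProduct_left _ h₁ _
    (ObjectProperty.monotone_extensionProduct_right _ h₂ _ ?_)
  rw [ObjectProperty.extensionProduct_assoc, ← ObjectProperty.extensionProduct_assoc 𝒯]
  refine ⟨_, _, _, _, _, distTriang_trunc t 0 E,
    (t.isLE_truncLT_obj E 0 (-1)).le, ?_⟩
  let G := (t.truncGE 0).obj E
  refine ⟨_, _, _, _, _, distTriang_trunc t 1 G, ?_, t.ge_of_isGE _ _⟩
  obtain ⟨X, Y, f, g, k, hX, hY, hT⟩ := h.exists_triangle ((t.truncLT 1).obj G)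
    ⟨(t.isLE_truncLT_obj G 1 0).le, t.ge_of_isGE _ _⟩
  exact ⟨X, Y, f, g, k, hT, hX, hY⟩

/-- The t-structure obtained by tilting at a torsion pair in the heart of a t-structure. -/
def tiltTStructure [IsTriangulated D] (h : IsHeartTorsionPair t.heart 𝒯 ℱ) : TStructure D where
  le n := (tiltLE t ℱ).shift n
  -- `tiltGE` is the coaisle in degrees `≥ 1`, hence the offset.
  ge n := (tiltGE t 𝒯).shift (n - 1)
  le_shift n a n' hn X hX :=
    (tiltLE t ℱ).prop_of_iso ((shiftFunctorAdd' D a n' n hn).app X) hX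
  ge_shift n a n' hn X hX :=
    (tiltGE t 𝒯).prop_of_iso ((shiftFunctorAdd' D a (n' - 1) (n - 1) (by lia)).app X) hX
  zero' X Y f hX hY := h.tilt_zero f ((tiltLE t ℱ).prop_of_iso ((shiftFunctorZero D ℤ).app X) hX)
    ((tiltGE t 𝒯).prop_of_iso ((shiftFunctorZero' D (1 - 1 : ℤ) (by lia)).app Y) hY)
  le_zero_le X hX := by
    have : t.IsLE (X⟦(0 : ℤ)⟧) 0 := ⟨hX.1⟩
    have := t.isLE_of_shift X 0 0 0
    have := t.isLE_shift X 0 1 (-1)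
    exact h.tiltLE_of_isLE _
  ge_one_le X hX := by
    have : t.IsGE (X⟦(1 - 1 : ℤ)⟧) 0 := ⟨hX.1⟩
    have := t.isGE_of_shift X 0 (1 - 1) 0
    have := t.isGE_shift X 0 (0 - 1) 1
    exact h.tiltGE_of_isGE _
  exists_triangle_zero_one E := by
    obtain ⟨X, Y, f, g, k, hT, hX, hY⟩ := h.exists_tilt_triangle E
    exact ⟨X, Y, (tiltLE t ℱ).prop_of_iso ((shiftFunctorZero D ℤ).symm.app X) hX,
      (tiltGE t 𝒯).prop_of_iso ((shiftFunctorZero' D (1 - 1 : ℤ) (by lia)).symm.app Y) hY,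
      f, g, k, hT⟩

variable [IsTriangulated D] (h : IsHeartTorsionPair t.heart 𝒯 ℱ)

lemma tiltTStructure_isLE_zero_iff (X : D) :
    (tiltTStructure h).IsLE X 0 ↔ tiltLE t ℱ X := by
  rw [← TStructure.le_iff_isLE]
  exact (tiltLE t ℱ).prop_iff_of_iso ((shiftFunctorZero D ℤ).app X)

lemma tiltTStructure_isGE_one_iff (X : D) :
    (tiltTStructure h).IsGE X 1 ↔ tiltGE t 𝒯 X := by
  rw [← TStructure.ge_iff_isGE]
  exact (tiltGE t 𝒯).prop_iff_of_iso ((shiftFunctorZero' D (1 - 1 : ℤ) (by lia)).app X)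

lemma tiltTStructure_isGE_zero_iff (X : D) :
    (tiltTStructure h).IsGE X 0 ↔ tiltGE t 𝒯 (X⟦(-1 : ℤ)⟧) := by
  rw [← tiltTStructure_isGE_one_iff h, (tiltTStructure h).isGE_shift_iff X 0 (-1) 1]

lemma tiltTStructure_heart : (tiltTStructure h).heart = tilt 𝒯 ℱ := by
  have := h.torsionFree_iso
  have := h.torsion_iso
  rw [tilt_eq_extensionProduct]
  ext E
  rw [TStructure.mem_heart_iff, tiltTStructure_isLE_zero_iff, tiltTStructure_isGE_zero_iff]
  constructor
  · rintro ⟨hE, hE'⟩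
    refine ⟨_, _, _, _, _, distTriang_trunc t 0 E, ?_, h.truncGE_of_tiltLE hE⟩
    have : t.IsGE (E⟦(-1 : ℤ)⟧) 0 := ⟨hE'.1⟩
    have := t.isGE_of_shift E (-1) (-1) 0
    have := t.isLE_truncLT_obj E 0 (-1)
    refine h.torsionFree_of_rightOrthogonal ⟨(t.isLE_shift _ (-1) (-1) 0).le,
      (t.isGE_shift _ (-1) (-1) 0).ge⟩ (fun Y f hY ↦ ?_)
    have : t.IsLE Y 0 := ⟨(h.torsion_le _ hY).1⟩
    -- The composite of `f` with the map to `E⟦-1⟧` vanishes, so `f` comes from the preceding vertex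
    -- of the triangle. That vertex lies in degrees `≥ 2`, while `Y` lies in degrees `≤ 0`.
    obtain ⟨g, hg⟩ : ∃ g : Y ⟶ (((t.truncGE 0).obj E)⟦(-1 : ℤ)⟧)⟦(-1 : ℤ)⟧, f = g ≫ _ :=
      Triangle.coyoneda_exact₂ _ (inv_rot_of_distTriang _ (Triangle.shift_distinguished _
        (distTriang_trunc t 0 E) (-1))) f (hE'.2 _ hY)
    have := t.isGE_shift ((t.truncGE 0).obj E) 0 (-1) 1
    have := t.isGE_shift (((t.truncGE 0).obj E)⟦(-1 : ℤ)⟧) 1 (-1) 2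
    rw [hg, t.zero g 0 2]
    exact zero_comp
  · rintro ⟨A, B, f, g, k, hT, hA, hB⟩
    have : t.IsLE (A⟦(-1 : ℤ)⟧) 0 := ⟨(h.torsionFree_le _ hA).1⟩
    have : t.IsGE (A⟦(-1 : ℤ)⟧) 0 := ⟨(h.torsionFree_le _ hA).2⟩
    have : t.IsLE A (-1) := t.isLE_of_shift A (-1) (-1) 0
    have : t.IsGE B 0 := ⟨(h.torsion_le _ hB).2⟩
    have : t.IsLE B 0 := ⟨(h.torsion_le _ hB).1⟩
    have := t.isGE_shift B 0 (-1) 1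
    have hT' := Triangle.shift_distinguished _ hT (-1)
    refine ⟨⟨(t.isLE₂ _ hT 0 (t.isLE_of_le A (-1) 0) ‹_›).le, fun Y φ hY ↦ ?_⟩,
      ⟨(t.isGE₂ _ hT' 0 ‹_› (t.isGE_of_ge (B⟦(-1 : ℤ)⟧) 0 1)).ge, fun Y φ hY ↦ ?_⟩⟩
    · have : t.IsGE Y 0 := ⟨(h.torsionFree_le _ hY).2⟩
      obtain ⟨ψ, rfl⟩ := exists_desc_of_distTriang hT φ (t.zero (f ≫ φ) (-1) 0)
      rw [h.hom_eq_zero ψ hB hY, comp_zero]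
    · have : t.IsLE Y 0 := ⟨(h.torsion_le _ hY).1⟩
      obtain ⟨ψ : Y ⟶ A⟦(-1 : ℤ)⟧, hψ⟩ := Triangle.coyoneda_exact₂ _ hT' φ
        (t.zero (Y := B⟦(-1 : ℤ)⟧) _ 0 1)
      rw [hψ, h.hom_eq_zero ψ hY hA]
      exact zero_comp

lemma tiltTStructure_bounded (X : D) (hX : t.bounded X) : (tiltTStructure h).bounded X := by
  obtain ⟨⟨a, ha⟩, ⟨b, hb⟩⟩ := hX
  refine ⟨⟨a, ⟨?_⟩⟩, ⟨b + 1, ⟨?_⟩⟩⟩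
  · have := t.isGE_shift X a (a - 1) 1
    exact h.tiltGE_of_isGE _
  · have := t.isLE_shift X b (b + 1) (-1)
    exact h.tiltLE_of_isLE _

end TiltedTStructure

/-! ### Two t-structures with interleaved aisles. -/

section Comparison

variable {D : Type u} [Category.{v} D] [Preadditive D] [HasZeroObject D] [HasShift D ℤ]
  [∀ n : ℤ, (shiftFunctor D n).Additive] [Pretriangulated D]

lemma isGE_of_forall_isLE [IsTriangulated D] {s t : TStructure D} {a b : ℤ}
    (hst : ∀ X, s.IsLE X a → t.IsLE X b)
    (X : D) (hX : t.IsGE X (b + 1)) : s.IsGE X (a + 1) := by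
  rw [s.isGE_iff_orthogonal a (a + 1) rfl]
  intro Y f hY
  have := hst Y hY
  exact t.zero f b (b + 1)

lemma isLE_of_forall_isGE [IsTriangulated D] {s t : TStructure D} {a b : ℤ}
    (hst : ∀ X, s.IsGE X a → t.IsGE X b)
    (X : D) (hX : t.IsLE X (b - 1)) : s.IsLE X (a - 1) := by
  rw [s.isLE_iff_orthogonal (a - 1) a (by lia)]
  intro Y f hY
  have := hst Y hY
  exact t.zero f (b - 1) b

/-- A t-structure whose aisle lies between the aisle of `s` and its shift by `1` is obtained
from `s` by tilting. -/
lemma isTiltAt_of_isLE [IsTriangulated D] (s t : TStructure D)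
    (h₁ : ∀ X, s.IsLE X (-1) → t.IsLE X 0) (h₂ : ∀ X, t.IsLE X 0 → s.IsLE X 0) :
    IsTiltAt s.heart (s.heart ⊓ t.heart) (s.heart ⊓ t.heart.shift (1 : ℤ)) t.heart := by
  -- Passing to orthogonals turns the two inclusions of aisles into reversed inclusions of coaisles;
  -- `h₅` and `h₆` are shifts of `h₁` and `h₄`.
  have h₃ (X : D) (hX : t.IsGE X 1) : s.IsGE X 0 := isGE_of_forall_isLE (b := 0) h₁ X hX
  have h₄ (X : D) (hX : s.IsGE X 1) : t.IsGE X 1 := isGE_of_forall_isLE (b := 0) h₂ X hX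
  have h₅ (X : D) (hX : s.IsLE X 0) : t.IsLE X 1 := by
    have := h₁ _ (s.isLE_shift X 0 1 (-1))
    exact t.isLE_of_shift X 1 1 0
  have h₆ (X : D) (hX : s.IsGE X 0) : t.IsGE X 0 := by
    have := h₄ _ (s.isGE_shift X 0 (-1) 1)
    exact t.isGE_of_shift X 0 (-1) 1
  have hshift (X : D) : t.heart.shift (1 : ℤ) X ↔ t.IsLE X 1 ∧ t.IsGE X 1 := by
    rw [ObjectProperty.prop_shift_iff, TStructure.mem_heart_iff, t.isLE_shift_iff X 1 1 0,
      t.isGE_shift_iff X 1 1 0]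
  have hiso : (s.heart ⊓ t.heart.shift (1 : ℤ)).IsClosedUnderIsomorphisms := inferInstance
  refine ⟨⟨inf_le_left, inf_le_left, inferInstance, hiso, ?_, ?_⟩, ?_⟩
  · rintro X Y f ⟨-, hX⟩ ⟨-, hY⟩
    rw [hshift] at hY
    have := hY.2
    have : t.IsLE X 0 := ⟨hX.1⟩
    exact t.zero f 0 1
  · intro E hE
    rw [TStructure.mem_heart_iff] at hE
    -- The torsion sequence in the heart of `s` is the truncation triangle of `t`.
    have hT := distTriang_trunc t 1 E
    have hX : t.IsLE ((t.truncLT 1).obj E) 0 := t.isLE_truncLT_obj E 1 0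
    have hY : t.IsGE ((t.truncGE 1).obj E) 1 := inferInstance
    have hXs := h₂ _ hX
    have hYs := h₃ _ hY
    have hYs' : s.IsLE ((t.truncGE 1).obj E) 0 :=
      isLE_right_of_distTriang hT s 0 (s.isLE_of_le _ 0 (0 + 1)) hE.1
    have hXs' : s.IsGE ((t.truncLT 1).obj E) 0 :=
      isGE_left_of_distTriang hT s 0 hE.2 (s.isGE_of_ge _ (0 - 1) 0)
    refine ⟨_, _, _, _, _, ⟨?_, ?_⟩, ⟨?_, ?_⟩, hT⟩
    · exact (s.mem_heart_iff _).2 ⟨hXs, hXs'⟩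
    · exact (t.mem_heart_iff _).2 ⟨hX, h₆ _ hXs'⟩
    · exact (s.mem_heart_iff _).2 ⟨hYs', hYs⟩
    · exact (hshift _).2 ⟨h₅ _ hYs', hY⟩
  · rw [tilt_eq_extensionProduct]
    ext E
    constructor
    · intro hE
      rw [TStructure.mem_heart_iff] at hE
      have hEs := h₂ _ hE.1
      have hEs' : s.IsGE E (-1) := by
        have := hE.2
        have := h₃ _ (t.isGE_shift E 0 (-1) 1)
        exact s.isGE_of_shift E (-1) (-1) 0
      -- The roles are exchanged: the truncation triangle of `s` exhibits `E` as an object of the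
      -- tilt.
      have hT := distTriang_trunc s 0 E
      have hA : s.IsLE ((s.truncLT 0).obj E) (-1) := s.isLE_truncLT_obj E 0 (-1)
      have hB : s.IsGE ((s.truncGE 0).obj E) 0 := inferInstance
      have hAt := h₁ _ hA
      have hBt := h₆ _ hB
      have hAt' : t.IsGE ((s.truncLT 0).obj E) 0 :=
        isGE_left_of_distTriang hT t 0 hE.2 (t.isGE_of_ge _ (0 - 1) 0)
      have hBt' : t.IsLE ((s.truncGE 0).obj E) 0 :=
        isLE_right_of_distTriang hT t 0 (t.isLE_of_le _ 0 (0 + 1)) hE.1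
      refine ⟨_, _, _, _, _, hT, ⟨?_, ?_⟩, ⟨?_, ?_⟩⟩
      · exact (s.mem_heart_iff _).2 ⟨s.isLE_shift _ (-1) (-1) 0, s.isGE_shift _ (-1) (-1) 0⟩
      · exact (hshift _).2 ⟨t.isLE_shift _ 0 (-1) 1, t.isGE_shift _ 0 (-1) 1⟩
      · exact (s.mem_heart_iff _).2 ⟨h₂ _ hBt', hB⟩
      · exact (t.mem_heart_iff _).2 ⟨hBt', hBt⟩
    · rintro ⟨A, B, f, g, k, hT, ⟨-, hA⟩, ⟨-, hB⟩⟩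
      rw [hshift] at hA
      rw [TStructure.mem_heart_iff] at hB ⊢
      have := hA.1
      have := hA.2
      exact ⟨t.isLE₂ _ hT 0 (t.isLE_of_shift A 0 (-1) 1) hB.1,
        t.isGE₂ _ hT 0 (t.isGE_of_shift A 0 (-1) 1) hB.2⟩

end Comparison

/-! ### Killing cocycles by quasi-isomorphisms of bounded complexes. -/

section BoundedFractions

variable {C : Type u} [Category.{v} C] [Abelian C]

lemma exists_truncLE_lift {K L : CochainComplex C ℤ} (φ : K ⟶ L) (n : ℤ) [K.IsStrictlyLE n] :
    ∃ ψ : K ⟶ L.truncLE n, ψ ≫ L.ιTruncLE n = φ :=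
  ⟨inv (K.ιTruncLE n) ≫ CochainComplex.truncLEMap φ n, by simp⟩

/-- Maps `T ⟶ L.X i` are the chain maps to `L` from the complex `T = T` in degrees `i, i + 1`. This
complex lives in degrees `≤ n`, so such maps lift to the truncation. -/
lemma exists_truncLE_lift_X {L : CochainComplex C ℤ} {T : C} {i j : ℤ} (hij : i + 1 = j) {n : ℤ}
    (hn : j ≤ n) (g : T ⟶ L.X i) : ∃ g' : T ⟶ (L.truncLE n).X i, g' ≫ (L.ιTruncLE n).f i = g := by
  have hrel : (ComplexShape.up ℤ).Rel i j := hij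
  let D : CochainComplex C ℤ := HomologicalComplex.double (𝟙 T) hrel
  have : D.IsStrictlyLE n := by
    rw [CochainComplex.isStrictlyLE_iff]
    intro k hk
    exact HomologicalComplex.isZero_double_X _ _ k (by lia) (by lia)
  let ψ : D ⟶ L := HomologicalComplex.mkHomFromDouble hrel (by lia) g (g ≫ L.d i j) (by simp)
    (by simp)
  obtain ⟨ψ', hψ'⟩ := exists_truncLE_lift ψ n
  refine ⟨(HomologicalComplex.doubleXIso₀ (𝟙 T) hrel).inv ≫ ψ'.f i, ?_⟩
  rw [Category.assoc, ← HomologicalComplex.comp_f, hψ']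
  simp [ψ]

variable [HasDerivedCategory.{w} C]

lemma exists_homotopy_zero_of_Q_map_eq_zero {K L : CochainComplex C ℤ} (φ : K ⟶ L)
    (hφ : DerivedCategory.Q.map φ = 0) :
    ∃ (L' : CochainComplex C ℤ) (p : L ⟶ L'), QuasiIso p ∧ Nonempty (Homotopy (φ ≫ p) 0) := by
  have h₁ : DerivedCategory.Qh.map ((HomotopyCategory.quotient C (.up ℤ)).map φ) =
      DerivedCategory.Qh.map 0 := by
    rw [← cancel_mono ((DerivedCategory.quotientCompQhIso C).hom.app L),
      DerivedCategory.quotientCompQhIso_hom_naturality, hφ, comp_zero, Functor.map_zero]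
    exact zero_comp.symm
  obtain ⟨M, s, hs, fac⟩ := (MorphismProperty.map_eq_iff_postcomp DerivedCategory.Qh
    (HomotopyCategory.quasiIso C (.up ℤ)) _ _).1 h₁
  obtain ⟨M, rfl⟩ := HomotopyCategory.quotient_obj_surjective M
  obtain ⟨s, rfl⟩ := (HomotopyCategory.quotient _ _).map_surjective s
  refine ⟨M, s, (HomotopyCategory.quotient_map_mem_quasiIso_iff s).1 hs, ?_⟩
  rw [← HomotopyCategory.quotient_map_eq_zero_iff, Functor.map_comp, fac, zero_comp]

/-- The cocycle is a chain map from `T` placed in degree `j`. It is zero in the derived category,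
hence null-homotopic after a quasi-isomorphism `q`, and the homotopy supplies `g`. The target of `q`
may be unbounded; it is truncated on both sides. -/
lemma exists_quasiIso_cocycle_eq_boundary {L : CochainComplex C ℤ} {a b : ℤ}
    [L.IsStrictlyGE a] [L.IsStrictlyLE b] {T : C} {i j k : ℤ} (hij : i + 1 = j) (hjk : j + 1 = k)
    (f : T ⟶ L.X j) (hf : f ≫ L.d j k = 0)
    (hT : ∀ φ : (DerivedCategory.singleFunctor C j).obj T ⟶ DerivedCategory.Q.obj L, φ = 0) :
    ∃ (L' : CochainComplex C ℤ) (p : L ⟶ L') (g : T ⟶ L'.X i),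
      boundedComplex C L' ∧ QuasiIso p ∧ f ≫ p.f j = g ≫ L'.d i j := by
  let φ : (HomologicalComplex.single C (.up ℤ) j).obj T ⟶ L :=
    HomologicalComplex.mkHomFromSingle f (by rintro l rfl; obtain rfl := hjk; exact hf)
  obtain ⟨M, q, hq, ⟨H⟩⟩ := exists_homotopy_zero_of_Q_map_eq_zero φ (hT _)
  obtain ⟨M₁, q₁, hM₁, hq₁, h, hh⟩ : ∃ (M₁ : CochainComplex C ℤ) (q₁ : L ⟶ M₁),
      M₁.IsStrictlyGE a ∧ QuasiIso q₁ ∧ ∃ h : T ⟶ M₁.X i, f ≫ q₁.f j = h ≫ M₁.d i j := by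
    have : M.IsGE a := by
      rw [← DerivedCategory.isGE_Q_obj_iff]
      have : IsIso (DerivedCategory.Q.map q) := by
        rwa [DerivedCategory.isIso_Q_map_iff_quasiIso]
      exact DerivedCategory.TStructure.t.isGE_of_iso (asIso (DerivedCategory.Q.map q)) a
    refine ⟨M.truncGE a, q ≫ M.πTruncGE a, inferInstance, inferInstance,
      (HomologicalComplex.singleObjXSelf (.up ℤ) j T).inv ≫ H.hom j i ≫ (M.πTruncGE a).f i, ?_⟩
    have := H.comm j
    rw [prevD_eq _ (show (ComplexShape.up ℤ).Rel i j from hij),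
      dNext_eq _ (show (ComplexShape.up ℤ).Rel j k from hjk)] at this
    simp only [HomologicalComplex.comp_f, HomologicalComplex.single_obj_d, zero_comp, zero_add,
      HomologicalComplex.zero_f, add_zero, φ, HomologicalComplex.mkHomFromSingle_f,
      Category.assoc] at this
    rw [← cancel_epi (HomologicalComplex.singleObjXSelf (.up ℤ) j T).hom]
    simp [reassoc_of% this]
  -- The bound `b ≤ n` lifts the chain map out of `L` to the truncation; `j ≤ n` lifts the primitive
  -- `h` in degree `i = j - 1`.
  let n := max b j
  have : L.IsStrictlyLE n := L.isStrictlyLE_of_le b n (le_max_left _ _)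
  obtain ⟨p, hp⟩ := exists_truncLE_lift q₁ n
  obtain ⟨g, hg⟩ := exists_truncLE_lift_X hij (le_max_right b j) h
  have : M₁.IsLE n := by
    rw [← DerivedCategory.isLE_Q_obj_iff]
    have : IsIso (DerivedCategory.Q.map q₁) := by
      rwa [DerivedCategory.isIso_Q_map_iff_quasiIso]
    exact DerivedCategory.TStructure.t.isLE_of_iso (asIso (DerivedCategory.Q.map q₁)) n
  refine ⟨M₁.truncLE n, p, g, ⟨a, n, inferInstance, inferInstance⟩, ?_, ?_⟩
  · rw [← hp] at hq₁
    exact quasiIso_of_comp_right p (M₁.ιTruncLE n)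
  · have : Mono ((M₁.ιTruncLE n).f j) := inferInstanceAs
      (Mono ((HomologicalComplex.ιTruncLE M₁ (ComplexShape.embeddingUpIntLE n)).f j))
    rw [← cancel_mono ((M₁.ιTruncLE n).f j)]
    have h₁ := congr_arg (fun φ ↦ φ.f j) hp
    simp only [HomologicalComplex.comp_f] at h₁
    rw [Category.assoc, h₁, hh, Category.assoc, ← HomologicalComplex.Hom.comm, reassoc_of% hg]

end BoundedFractions

/-! ### Vanishing of `Φʲ` outside the range of the homological dimension. -/

section Vanishing

variable {Z : Type u} [Category.{v} Z] [Abelian Z]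

lemma isZero_homology_of_isZero_homology_mapDerivedCategory {C : Type*} [Category* C] [Abelian C]
    [HasDerivedCategory.{w} C] {C' : Type*} [Category* C'] [Abelian C'] [HasDerivedCategory.{w₁} C']
    (F : C ⥤ C') [F.Additive] [PreservesFiniteLimits F] [PreservesFiniteColimits F] [F.Faithful]
    (X : DerivedCategory C) (i : ℤ)
    (h : IsZero ((DerivedCategory.homologyFunctor C' i).obj (F.mapDerivedCategory.obj X))) :
    IsZero ((DerivedCategory.homologyFunctor C i).obj X) := by
  let K := DerivedCategory.Q.objPreimage X
  let e : DerivedCategory.Q.obj K ≅ X := DerivedCategory.Q.objObjPreimageIso X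
  let e₁ : (DerivedCategory.homologyFunctor C' i).obj (F.mapDerivedCategory.obj X) ≅
      F.obj (K.homology i) :=
    (DerivedCategory.homologyFunctor C' i).mapIso
      (F.mapDerivedCategory.mapIso e.symm ≪≫ F.mapDerivedCategoryFactors.app K) ≪≫
      (DerivedCategory.homologyFunctorFactors C' i).app _ ≪≫ (K.sc i).mapHomologyIso F
  let e₂ : (DerivedCategory.homologyFunctor C i).obj X ≅ K.homology i :=
    (DerivedCategory.homologyFunctor C i).mapIso e.symm ≪≫
      (DerivedCategory.homologyFunctorFactors C i).app _
  refine IsZero.of_iso ?_ e₂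
  rw [IsZero.iff_id_eq_zero]
  apply F.map_injective
  rw [F.map_id, F.map_zero]
  exact (IsZero.iff_id_eq_zero _).1 (h.of_iso e₁.symm)

lemma homologyMap_homologyπ_eq_zero {R : Type v} [Ring R]
    {K L : CochainComplex (ModuleCat.{v} R) ℤ} (p : K ⟶ L) (i j : ℤ)
    (y : K.cycles j) (g : L.X i) (hg : p.f j (K.iCycles j y) = L.d i j g) :
    HomologicalComplex.homologyMap p j (K.homologyπ j y) = 0 := by
  have h₁ : HomologicalComplex.cyclesMap p j y = L.toCycles i j g := by
    apply (ModuleCat.mono_iff_injective (L.iCycles j)).1 inferInstance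
    rw [← ConcreteCategory.comp_apply, ← ConcreteCategory.comp_apply,
      HomologicalComplex.cyclesMap_i, HomologicalComplex.toCycles_i, ConcreteCategory.comp_apply, hg]
  rw [← ConcreteCategory.comp_apply, HomologicalComplex.homologyπ_naturality,
    ConcreteCategory.comp_apply, h₁, ← ConcreteCategory.comp_apply,
    HomologicalComplex.toCycles_comp_homologyπ]
  rfl

lemma exists_quasiIso_cocycle_eq_boundary_of_neg {L : CochainComplex Z ℤ} (hL : boundedComplex Z L)
    {a : ℤ} [L.IsGE a] {T : Z} {i j : ℤ} (hj : j < a) (f : T ⟶ L.X j) :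
    ∃ (L' : CochainComplex Z ℤ) (p : L ⟶ L') (g : T ⟶ L'.X i),
      boundedComplex Z L' ∧ QuasiIso p ∧ f ≫ p.f j = g ≫ L'.d i j := by
  obtain ⟨_, b, _, _⟩ := hL
  exact ⟨L.truncGE a, L.πTruncGE a, 0, ⟨a, b, inferInstance, inferInstance⟩, inferInstance,
    ((L.truncGE a).isZero_of_isStrictlyGE a j hj).eq_of_tgt _ _⟩

variable [HasDerivedCategory.{w₁} Z]

/-- Such a map is, up to a shift by `j`, an element of `Extʲ(E, F)`. -/
lemma singleFunctor_hom_eq_zero [HasExt.{w₀} Z] {n : ℕ} (hdim : HasHomologicalDimension.{w₀} Z n)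
    (E F : Z) {j : ℤ} (hj : n < j)
    (φ : (DerivedCategory.singleFunctor Z j).obj E ⟶ (DerivedCategory.singleFunctor Z 0).obj F) :
    φ = 0 := by
  lift j to ℕ using by lia
  have := hdim E F j (by lia)
  have hs : Subsingleton (ShiftedHom ((DerivedCategory.singleFunctor Z 0).obj E)
      ((DerivedCategory.singleFunctor Z 0).obj F) (j : ℤ)) :=
    Abelian.Ext.homEquiv.symm.subsingleton
  let e := ((DerivedCategory.singleFunctors Z).shiftIso (j : ℤ) 0 j (by simp)).app E
  apply (shiftFunctor (DerivedCategory Z) (j : ℤ)).map_injective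
  rw [Functor.map_zero, ← cancel_epi e.inv]
  exact hs.elim _ _

variable {T : Z} [HasDerivedCategory.{w₃} (ModuleCat.{v} (EndOp T))]

/-- For `L` and `σ` given by Deligne's condition, the composite `R(QK) ⟶ Hom(T, L) ⟶ Hom(T, L') ⟶
R(QL')` is `R` of an isomorphism. On `Hʲ` it is injective, yet it kills a class once a representing
cocycle `T ⟶ L.X j` becomes a boundary in `L'`. No injective resolutions enter. -/
lemma isZero_homology_of_isRightDerivedFunctor
    {R : DerivedCategory.Bounded Z ⥤ DerivedCategory (ModuleCat.{v} (EndOp T))}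
    {α : homComplex T ⟶ boundedQ Z ⋙ R} (hR : IsRightDerivedFunctor (homComplex T) R α)
    (K : (boundedComplex Z).FullSubcategory) {i j k : ℤ}
    (h : ∀ (L : CochainComplex Z ℤ) (f : T ⟶ L.X j), boundedComplex Z L →
      Nonempty (DerivedCategory.Q.obj L ≅ DerivedCategory.Q.obj K.obj) → f ≫ L.d j k = 0 →
      ∃ (L' : CochainComplex Z ℤ) (p : L ⟶ L') (g : T ⟶ L'.X i),
        boundedComplex Z L' ∧ QuasiIso p ∧ f ≫ p.f j = g ≫ L'.d i j) :
    IsZero ((DerivedCategory.homologyFunctor _ j).obj (R.obj ((boundedQ Z).obj K))) := by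
  obtain ⟨L, s, σ, hs, -, hσ⟩ := hR K
  have isIso_Q {M M' : (boundedComplex Z).FullSubcategory} (p : M ⟶ M')
      (hp : QuasiIso ((boundedComplex Z).ι.map p)) : IsIso ((boundedQ Z).map p) := by
    have : IsIso (DerivedCategory.Bounded.ι.map ((boundedQ Z).map p)) :=
      (DerivedCategory.isIso_Q_map_iff_quasiIso _ _).2 hp
    exact isIso_of_reflects_iso _ DerivedCategory.Bounded.ι
  have := isIso_Q s hs
  let H := DerivedCategory.homologyFunctor (ModuleCat.{v} (EndOp T)) j
  let F := (preadditiveCoyonedaObj T).mapHomologicalComplex (.up ℤ)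
  let e (M : (boundedComplex Z).FullSubcategory) :
      H.obj ((homComplex T).obj M) ≅ (F.obj M.obj).homology j :=
    (DerivedCategory.homologyFunctorFactors _ j).app (F.obj M.obj)
  suffices ∀ x : H.obj (R.obj ((boundedQ Z).obj K)), x = 0 by
    have : Subsingleton (H.obj (R.obj ((boundedQ Z).obj K))) := ⟨fun x y ↦ by rw [this x, this y]⟩
    exact ModuleCat.isZero_of_subsingleton _
  intro x
  obtain ⟨y, hy⟩ := (ModuleCat.epi_iff_surjective ((F.obj L.obj).homologyπ j)).1 inferInstance
    ((e L).hom (H.map σ x))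
  -- `L'` depends on the class `x`; this is harmless, as the classes are killed one at a time.
  obtain ⟨L', p, g, hL', hp, hg⟩ := h L.obj ((F.obj L.obj).iCycles j y) L.property
    ⟨(DerivedCategory.Bounded.ι.mapIso (asIso ((boundedQ Z).map s))).symm⟩ (by
      have : (F.obj L.obj).d j k ((F.obj L.obj).iCycles j y) = 0 := by
        rw [← ConcreteCategory.comp_apply, HomologicalComplex.iCycles_d]
        rfl
      exact this)
  let p' : L ⟶ ⟨L', hL'⟩ := ObjectProperty.homMk p
  have := isIso_Q p' hp
  have h₁ : H.map ((homComplex T).map p') (H.map σ x) = 0 := by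
    apply (ModuleCat.mono_iff_injective (e _).hom).1 inferInstance
    have := homologyMap_homologyπ_eq_zero (F.map p) i j y g hg
    rw [hy] at this
    rw [map_zero, ← this, ← ConcreteCategory.comp_apply, ← ConcreteCategory.comp_apply]
    exact ConcreteCategory.congr_hom
      ((DerivedCategory.homologyFunctorFactors _ j).hom.naturality (F.map p)) _
  have h₂ : σ ≫ (homComplex T).map p' ≫ α.app _ =
      R.map ((boundedQ Z).map s ≫ (boundedQ Z).map p') := by
    rw [R.map_comp, ← hσ, Category.assoc]
    congr 1
    exact α.naturality p'
  have h₃ : IsIso (H.map (σ ≫ (homComplex T).map p' ≫ α.app _)) := by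
    rw [h₂]
    infer_instance
  apply (ModuleCat.mono_iff_injective _).1 (inferInstance :
    Mono (H.map (σ ≫ (homComplex T).map p' ≫ α.app _)))
  rw [map_zero, H.map_comp, H.map_comp, ConcreteCategory.comp_apply, ConcreteCategory.comp_apply, h₁,
    map_zero]

end Vanishing

namespace TiltingEquivalence

variable {Z : Type u} [Category.{v} Z] [Abelian Z] [HasExt.{w₀} Z] [HasDerivedCategory.{w₁} Z]
  {T : Z} [IsNoetherianRing (EndOp T)]
  [HasDerivedCategory.{w₂} (FGModuleCat.{v} (EndOp T))]
  [HasDerivedCategory.{w₃} (ModuleCat.{v} (EndOp T))]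
  (Φ : TiltingEquivalence.{w₀, w₁, w₂, w₃} T)

lemma isZero_coh {n : ℕ} (hdim : HasHomologicalDimension.{w₀} Z n) (E : Z) (j : ℤ)
    (hj : j < 0 ∨ n < j) : IsZero (Φ.coh j E) := by
  let K : (boundedComplex Z).FullSubcategory :=
    ⟨(HomologicalComplex.single Z (.up ℤ) 0).obj E, 0, 0, inferInstance, inferInstance⟩
  refine isZero_homology_of_isZero_homology_mapDerivedCategory
    (forget₂ (FGModuleCat.{v} (EndOp T)) (ModuleCat.{v} (EndOp T))) _ j
    (isZero_homology_of_isRightDerivedFunctor Φ.isRightDerivedFunctor K (i := j - 1)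
      (k := j + 1) ?_)
  rintro L f hL ⟨e⟩ hf
  -- In negative degrees, truncating `L` makes its degree `j` term zero; above `n`, the obstruction
  -- lies in `Extʲ(T, E) = 0`.
  obtain hj | hj := hj
  · have : L.IsGE 0 := by
      rw [← DerivedCategory.isGE_Q_obj_iff]
      exact DerivedCategory.TStructure.t.isGE_of_iso e.symm 0
    exact exists_quasiIso_cocycle_eq_boundary_of_neg hL hj f
  · obtain ⟨a, b, _, _⟩ := hL
    refine exists_quasiIso_cocycle_eq_boundary (a := a) (b := b) (by lia) rfl f hf fun φ ↦ ?_
    rw [← cancel_mono e.hom, zero_comp]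
    exact singleFunctor_hom_eq_zero hdim T E hj _

end TiltingEquivalence

/-! ### Torsion classes in noetherian abelian categories. -/

section TorsionClass

variable {Z : Type u} [Category.{v} Z] [Abelian Z]

/-- In a noetherian abelian category, a class of objects closed under quotients and extensions
is the torsion part of a torsion pair. -/
lemma isTorsionPair_rightOrthogonal (hZ : IsNoetherianCategory Z) (P : ObjectProperty Z)
    [P.IsClosedUnderQuotients] [P.IsClosedUnderExtensions] [P.ContainsZero] :
    IsTorsionPair P P.rightOrthogonal where
  torsion_iso := inferInstance
  torsionFree_iso := inferInstance
  hom_eq_zero _ _ f hX hY := hY f hX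
  exists_shortExact E := by
    have := hZ E
    obtain ⟨M, hM, hmax⟩ := wellFounded_gt.has_min {M : Subobject E | P (M : Z)}
      ⟨⊥, P.prop_of_isZero ((isZero_zero Z).of_iso Subobject.botCoeIsoZero)⟩
    refine ⟨ShortComplex.mk M.arrow (cokernel.π M.arrow) (cokernel.condition _),
      { exact := ShortComplex.exact_cokernel _
        mono_f := inferInstanceAs (Mono M.arrow)
        epi_g := inferInstanceAs (Epi (cokernel.π M.arrow)) }, hM, ⟨Iso.refl _⟩, ?_⟩
    intro G (f : G ⟶ cokernel M.arrow) hG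
    -- `N` is an extension of `G` by the maximal subobject `M`, so its image in `E` lies in `P` and
    -- contains `M`. By maximality the image is `M`, which forces `f = 0`.
    let N := pullback (cokernel.π M.arrow) f
    let p : N ⟶ E := pullback.fst _ _
    let q : N ⟶ G := pullback.snd _ _
    let i : (M : Z) ⟶ N := pullback.lift M.arrow 0 (by simp)
    have hip : i ≫ p = M.arrow := pullback.lift_fst _ _ _
    have hiq : i ≫ q = 0 := pullback.lift_snd _ _ _
    have hpq : p ≫ cokernel.π M.arrow = q ≫ f := pullback.condition
    have : Mono i := mono_of_mono_fac hip
    have hN : P N := by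
      refine P.prop_X₂_of_shortExact (S := ShortComplex.mk i q hiq)
        { exact := ShortComplex.exact_of_f_is_kernel _
            (KernelFork.IsLimit.ofι' i hiq
              (fun {W} k hk ↦ ⟨Abelian.monoLift M.arrow (k ≫ p) ?_, ?_⟩))
          mono_f := ‹_›
          epi_g := inferInstanceAs (Epi (pullback.snd (cokernel.π M.arrow) f)) } hM hG
      · rw [Category.assoc, hpq, reassoc_of% hk, zero_comp]
      · apply pullback.hom_ext
        · rw [Category.assoc]
          exact (congr_arg _ hip).trans (Abelian.monoLift_comp _ _ _)
        · rw [Category.assoc]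
          exact ((congr_arg _ hiq).trans comp_zero).trans hk.symm
    have hJ : P (imageSubobject p : Z) := P.prop_of_epi (factorThruImageSubobject p) hN
    have hMJ : M ≤ imageSubobject p :=
      Subobject.le_of_comm (i ≫ factorThruImageSubobject p) (by simp [hip])
    have hJM : imageSubobject p ≤ M := by
      rw [hMJ.eq_of_not_lt (hmax _ hJ)]
    have hp : p ≫ cokernel.π M.arrow = 0 := by
      rw [← imageSubobject_arrow_comp p, ← Subobject.ofLE_arrow hJM]
      simp only [Category.assoc, cokernel.condition, comp_zero]
    have : Epi q := inferInstanceAs (Epi (pullback.snd (cokernel.π M.arrow) f))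
    rw [← cancel_epi q, ← hpq, hp, comp_zero]

end TorsionClass

/-! ### Dévissage from hearts to aisles, and transport along an equivalence. -/

section Hearts

variable {D : Type u} [Category.{v} D] [Preadditive D] [HasZeroObject D] [HasShift D ℤ]
  [∀ n : ℤ, (shiftFunctor D n).Additive] [Pretriangulated D]

/-- Induction on the amplitude `n` of `X` for `t`, splitting off the top cohomology object. -/
lemma isLE_of_heart_le [IsTriangulated D] (s t : TStructure D) (b : ℤ) (h : ∀ X, t.heart X → s.IsLE X b)
    (n : ℕ) : ∀ (m : ℤ) (X : D), t.IsLE X m → t.IsGE X (m - n) → s.IsLE X (m + b) := by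
  induction n with
  | zero =>
    intro m X h₁ h₂
    have : t.IsGE X m := by simpa using h₂
    have := h (X⟦m⟧) ((t.mem_heart_iff _).2 ⟨t.isLE_shift X m m 0, t.isGE_shift X m m 0⟩)
    exact s.isLE_of_shift X (m + b) m b
  | succ n hn =>
    intro m X h₁ h₂
    refine s.isLE₂ _ (distTriang_trunc t m X) (m + b) ?_ ?_
    · have : t.IsGE X (m - 1 - n) := by convert h₂ using 1; push_cast; ring
      have := hn (m - 1) ((t.truncLT m).obj X) inferInstance inferInstance
      exact s.isLE_of_le ((t.truncLT m).obj X) (m - 1 + b) _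
    · let Y := (t.truncGE m).obj X
      have := h (Y⟦m⟧) ((t.mem_heart_iff _).2 ⟨t.isLE_shift Y m m 0, t.isGE_shift Y m m 0⟩)
      exact s.isLE_of_shift Y (m + b) m b

lemma isGE_of_heart_le [IsTriangulated D] (s t : TStructure D) (a : ℤ) (h : ∀ X, t.heart X → s.IsGE X a)
    (n : ℕ) : ∀ (m : ℤ) (X : D), t.IsGE X m → t.IsLE X (m + n) → s.IsGE X (m + a) := by
  induction n with
  | zero =>
    intro m X h₁ h₂
    have : t.IsLE X m := by simpa using h₂
    have := h (X⟦m⟧) ((t.mem_heart_iff _).2 ⟨t.isLE_shift X m m 0, t.isGE_shift X m m 0⟩)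
    exact s.isGE_of_shift X (m + a) m a
  | succ n hn =>
    intro m X h₁ h₂
    refine s.isGE₂ _ (distTriang_trunc t (m + 1) X) (m + a) ?_ ?_
    · let Y := (t.truncLT (m + 1)).obj X
      have := h (Y⟦m⟧) ((t.mem_heart_iff _).2 ⟨t.isLE_shift Y m m 0, t.isGE_shift Y m m 0⟩)
      exact s.isGE_of_shift Y (m + a) m a
    · have : t.IsLE X (m + 1 + n) := by convert h₂ using 1; push_cast; ring
      have := hn (m + 1) ((t.truncGE (m + 1)).obj X) inferInstance inferInstance
      exact s.isGE_of_ge ((t.truncGE (m + 1)).obj X) _ (m + 1 + a)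

variable {D' : Type w} [Category.{w₁} D'] [Preadditive D'] [HasZeroObject D'] [HasShift D' ℤ]
  [∀ n : ℤ, (shiftFunctor D' n).Additive] [Pretriangulated D']

/-- The pullback of a t-structure along an equivalence of triangulated categories. -/
def pullbackTStructure (F : D ⥤ D') [F.CommShift ℤ] [F.IsTriangulated] [F.IsEquivalence]
    (t : TStructure D') : TStructure D where
  le n := (t.le n).inverseImage F
  ge n := (t.ge n).inverseImage F
  le_shift n a n' h X hX :=
    (t.le n').prop_of_iso ((F.commShiftIso a).symm.app X) (t.le_shift n a n' h _ hX)
  ge_shift n a n' h X hX :=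
    (t.ge n').prop_of_iso ((F.commShiftIso a).symm.app X) (t.ge_shift n a n' h _ hX)
  zero' X Y f hX hY := F.map_injective (by rw [F.map_zero]; exact t.zero' _ hX hY)
  le_zero_le X hX := t.le_zero_le _ hX
  ge_one_le X hX := t.ge_one_le _ hX
  exists_triangle_zero_one X := by
    obtain ⟨A, B, hA, hB, f, g, k, hT⟩ := t.exists_triangle_zero_one (F.obj X)
    -- The triangle lifts along `F` only up to isomorphism, so its middle vertex must still be
    -- identified with `X`.
    obtain ⟨T, hT', ⟨e⟩⟩ := F.mem_mapTriangle_essImage_of_distinguished _ hT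
    have hT₂ : ((t.le 0).inverseImage F).extensionProduct ((t.ge 1).inverseImage F) T.obj₂ :=
      ⟨T.obj₁, T.obj₃, T.mor₁, T.mor₂, T.mor₃, hT',
        (t.le 0).prop_of_iso (Triangle.π₁.mapIso e).symm hA,
        (t.ge 1).prop_of_iso (Triangle.π₃.mapIso e).symm hB⟩
    obtain ⟨A', B', f', g', k', hT'', hA', hB'⟩ := ObjectProperty.prop_of_iso _
      (F.preimageIso (Triangle.π₂.mapIso e)) hT₂
    exact ⟨A', B', hA', hB', f', g', k', hT''⟩

end Hearts

/-! ### The standard t-structure on the bounded derived category. -/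

section BoundedDerived

variable (C : Type u) [Category.{v} C] [Abelian C] [HasDerivedCategory.{w} C]

/-- The standard t-structure on the bounded derived category. -/
abbrev boundedTStructure : TStructure (DerivedCategory.Bounded C) :=
  DerivedCategory.TStructure.t.onBounded

instance : (boundedSingle C).Full :=
  have : (boundedSingle C ⋙ DerivedCategory.Bounded.ι).Full :=
    inferInstanceAs (DerivedCategory.singleFunctor C 0).Full
  Functor.Full.of_comp_faithful _ DerivedCategory.Bounded.ι

instance : (boundedSingle C).Faithful :=
  have : (boundedSingle C ⋙ DerivedCategory.Bounded.ι).Faithful :=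
    inferInstanceAs (DerivedCategory.singleFunctor C 0).Faithful
  Functor.Faithful.of_comp _ DerivedCategory.Bounded.ι

instance : (boundedSingle C).Additive where
  map_add := DerivedCategory.Bounded.ι.map_injective (DerivedCategory.singleFunctor C 0).map_add

lemma bounded_boundedTStructure (X : DerivedCategory.Bounded C) :
    (boundedTStructure C).bounded X := by
  obtain ⟨⟨a, ha⟩, ⟨b, hb⟩⟩ := X.property
  exact ⟨⟨a, ⟨ha.1⟩⟩, ⟨b, ⟨hb.1⟩⟩⟩

variable {C}

lemma boundedTStructure_isLE_iff (X : DerivedCategory.Bounded C) (n : ℤ) :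
    (boundedTStructure C).IsLE X n ↔ ∀ i, n < i → IsZero ((boundedHomology C i).obj X) :=
  (ObjectProperty.tStructure_isLE_iff _ _ X n).trans (DerivedCategory.isLE_iff X.obj n)

lemma boundedTStructure_isGE_iff (X : DerivedCategory.Bounded C) (n : ℤ) :
    (boundedTStructure C).IsGE X n ↔ ∀ i, i < n → IsZero ((boundedHomology C i).obj X) :=
  (ObjectProperty.tStructure_isGE_iff _ _ X n).trans (DerivedCategory.isGE_iff X.obj n)

variable (C) in
lemma essImage_boundedSingle : (boundedSingle C).essImage = (boundedTStructure C).heart := by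
  ext X
  rw [TStructure.mem_heart_iff, ObjectProperty.tStructure_isLE_iff,
    ObjectProperty.tStructure_isGE_iff]
  constructor
  · rintro ⟨E, ⟨e⟩⟩
    let e' : (DerivedCategory.singleFunctor C 0).obj E ≅ X.obj :=
      DerivedCategory.Bounded.ι.mapIso e
    exact ⟨DerivedCategory.TStructure.t.isLE_of_iso e' 0,
      DerivedCategory.TStructure.t.isGE_of_iso e' 0⟩
  · rintro ⟨_, _⟩
    obtain ⟨E, ⟨e⟩⟩ :=
      DerivedCategory.exists_iso_singleFunctor_obj_of_isGE_of_isLE X.obj 0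
    exact ⟨E, ⟨DerivedCategory.Bounded.ι.preimageIso e.symm⟩⟩

lemma exists_distTriang_of_shortExact {S : ShortComplex C} (hS : S.ShortExact) :
    ∃ δ, Triangle.mk ((boundedSingle C).map S.f) ((boundedSingle C).map S.g) δ ∈
      distTriang (DerivedCategory.Bounded C) := by
  let P := (DerivedCategory.TStructure.t : TStructure (DerivedCategory C)).bounded
  refine ⟨P.fullyFaithfulι.preimage (hS.singleδ ≫
    (P.ι.commShiftIso (1 : ℤ)).inv.app ((boundedSingle C).obj S.X₁)), ?_⟩
  refine isomorphic_distinguished _ hS.singleTriangle_distinguished _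
    (Triangle.isoMk _ _ (Iso.refl _) (Iso.refl _) (Iso.refl _)
      ((Category.comp_id _).trans (Category.id_comp _).symm)
      ((Category.comp_id _).trans (Category.id_comp _).symm) ?_)
  have key {X Y : P.FullSubcategory} (φ : P.ι.obj X ⟶ (P.ι.obj Y)⟦(1 : ℤ)⟧) :
      P.ι.map (P.fullyFaithfulι.preimage (φ ≫ (P.ι.commShiftIso (1 : ℤ)).inv.app Y)) ≫
        (P.ι.commShiftIso (1 : ℤ)).hom.app Y = φ := by
    rw [Functor.FullyFaithful.map_preimage, Category.assoc, Iso.inv_hom_id_app]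
    exact Category.comp_id _
  refine (congr_arg₂ (· ≫ ·) (key (X := (boundedSingle C).obj S.X₃)
    (Y := (boundedSingle C).obj S.X₁) hS.singleδ) (CategoryTheory.Functor.map_id _ _)).trans ?_
  exact (Category.comp_id _).trans (Category.id_comp _).symm

lemma IsTorsionPair.isHeartTorsionPair {𝒯 ℱ : ObjectProperty C} (h : IsTorsionPair 𝒯 ℱ) :
    IsHeartTorsionPair (boundedTStructure C).heart (𝒯.map (boundedSingle C))
      (ℱ.map (boundedSingle C)) where
  torsion_le := by
    rw [← essImage_boundedSingle]
    rintro X ⟨E, -, ⟨e⟩⟩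
    exact ⟨E, ⟨e⟩⟩
  torsionFree_le := by
    rw [← essImage_boundedSingle]
    rintro X ⟨E, -, ⟨e⟩⟩
    exact ⟨E, ⟨e⟩⟩
  torsion_iso := inferInstance
  torsionFree_iso := inferInstance
  hom_eq_zero := by
    rintro X Y f ⟨E, hE, ⟨e⟩⟩ ⟨F, hF, ⟨e'⟩⟩
    rw [← cancel_epi e.hom, ← cancel_mono e'.inv, comp_zero, zero_comp,
      ← (boundedSingle C).map_preimage ((e.hom ≫ f) ≫ e'.inv),
      h.hom_eq_zero ((boundedSingle C).preimage _) hE hF, Functor.map_zero]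
  exists_triangle := by
    intro X hX
    rw [← essImage_boundedSingle] at hX
    obtain ⟨E, ⟨e⟩⟩ := hX
    obtain ⟨S, hS, h₁, ⟨e'⟩, h₃⟩ := h.exists_shortExact E
    obtain ⟨δ, hT⟩ := exists_distTriang_of_shortExact hS
    have hS₂ : ObjectProperty.extensionProduct (𝒯.map (boundedSingle C))
        (ℱ.map (boundedSingle C)) ((boundedSingle C).obj S.X₂) :=
      ⟨_, _, _, _, _, hT, ObjectProperty.prop_map_obj _ _ h₁, ObjectProperty.prop_map_obj _ _ h₃⟩
    obtain ⟨A, B, f, g, k, hT', hA, hB⟩ := ObjectProperty.prop_of_iso _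
      ((boundedSingle C).mapIso e' ≪≫ e) hS₂
    exact ⟨A, B, f, g, k, hA, hB, hT'⟩

end BoundedDerived

/-! ### The t-structure of `Φ` and the torsion class `ℬ₂`. -/

namespace TiltingEquivalence

variable {Z : Type u} [Category.{v} Z] [Abelian Z] [HasExt.{w₀} Z] [HasDerivedCategory.{w₁} Z]
  {T : Z} [IsNoetherianRing (EndOp T)]
  [HasDerivedCategory.{w₂} (FGModuleCat.{v} (EndOp T))]
  [HasDerivedCategory.{w₃} (ModuleCat.{v} (EndOp T))]
  (Φ : TiltingEquivalence.{w₀, w₁, w₂, w₃} T)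

/-- The t-structure on `Dᵇ(Z)` that corresponds under `Φ` to the standard one on `Dᵇ(mod Aᵒᵖ)`. -/
def tStructure : TStructure (DerivedCategory.Bounded Z) :=
  letI := Φ.commShift
  haveI := Φ.isTriangulated
  pullbackTStructure Φ.equiv.functor (boundedTStructure (FGModuleCat.{v} (EndOp T)))

lemma tStructure_isLE_iff (X : DerivedCategory.Bounded Z) (n : ℤ) :
    Φ.tStructure.IsLE X n ↔
      (boundedTStructure (FGModuleCat.{v} (EndOp T))).IsLE (Φ.equiv.functor.obj X) n :=
  ⟨fun h ↦ ⟨h.1⟩, fun h ↦ ⟨h.1⟩⟩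

lemma tStructure_isGE_iff (X : DerivedCategory.Bounded Z) (n : ℤ) :
    Φ.tStructure.IsGE X n ↔
      (boundedTStructure (FGModuleCat.{v} (EndOp T))).IsGE (Φ.equiv.functor.obj X) n :=
  ⟨fun h ↦ ⟨h.1⟩, fun h ↦ ⟨h.1⟩⟩

lemma tStructure_heart : Φ.tStructure.heart = Φ.H := by
  ext X
  rw [TStructure.mem_heart_iff, tStructure_isLE_iff, tStructure_isGE_iff,
    ← TStructure.mem_heart_iff, ← essImage_boundedSingle]
  constructor
  · rintro ⟨M, ⟨e⟩⟩
    exact ⟨M, ⟨Φ.equiv.inverse.mapIso e ≪≫ (Φ.equiv.unitIso.app X).symm⟩⟩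
  · rintro ⟨M, ⟨e⟩⟩
    exact ⟨M, ⟨(Φ.equiv.counitIso.app _).symm ≪≫ Φ.equiv.functor.mapIso e⟩⟩

lemma isBoundedHeart_H : IsBoundedHeart Φ.H := by
  refine ⟨Φ.tStructure, Φ.tStructure_heart, fun X ↦ ?_⟩
  obtain ⟨⟨a, ha⟩, ⟨b, hb⟩⟩ := bounded_boundedTStructure _ (Φ.equiv.functor.obj X)
  exact ⟨⟨a, (Φ.tStructure_isGE_iff X a).2 ha⟩, ⟨b, (Φ.tStructure_isLE_iff X b).2 hb⟩⟩

lemma isLE_single_iff (E : Z) (n : ℤ) :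
    Φ.tStructure.IsLE ((boundedSingle Z).obj E) n ↔ ∀ i, n < i → IsZero (Φ.coh i E) := by
  rw [tStructure_isLE_iff, boundedTStructure_isLE_iff]
  rfl

lemma isGE_single_iff (E : Z) (n : ℤ) :
    Φ.tStructure.IsGE ((boundedSingle Z).obj E) n ↔ ∀ i, i < n → IsZero (Φ.coh i E) := by
  rw [tStructure_isGE_iff, boundedTStructure_isGE_iff]
  rfl

section Amplitude

variable (hdim : HasHomologicalDimension.{w₀} Z 2)

include hdim

lemma isLE_single (E : Z) : Φ.tStructure.IsLE ((boundedSingle Z).obj E) 2 :=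
  (Φ.isLE_single_iff E 2).2 fun i hi ↦ Φ.isZero_coh hdim E i (Or.inr hi)

lemma isGE_single (E : Z) : Φ.tStructure.IsGE ((boundedSingle Z).obj E) 0 :=
  (Φ.isGE_single_iff E 0).2 fun i hi ↦ Φ.isZero_coh hdim E i (Or.inl hi)

lemma B_two_iff (E : Z) : Φ.B 2 E ↔ Φ.tStructure.IsLE ((boundedSingle Z).obj E) 1 := by
  rw [isLE_single_iff]
  refine ⟨fun h i hi ↦ ?_, fun h ↦ h 2 (by lia)⟩
  obtain rfl | hi : i = 2 ∨ 2 < i := by lia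
  · exact h
  · exact Φ.isZero_coh hdim E i (Or.inr hi)

lemma B_zero_iff (E : Z) : Φ.B 0 E ↔ Φ.tStructure.IsGE ((boundedSingle Z).obj E) 1 := by
  rw [isGE_single_iff]
  refine ⟨fun h i hi ↦ ?_, fun h ↦ h 0 (by lia)⟩
  obtain rfl | hi : i = 0 ∨ i < 0 := by lia
  · exact h
  · exact Φ.isZero_coh hdim E i (Or.inl hi)

lemma X_one_iff (E : Z) : Φ.X 1 E ↔ Φ.B 2 E ∧ Φ.B 0 E := by
  refine ⟨fun h ↦ ⟨h 2 (by lia), h 0 (by lia)⟩, fun ⟨h₂, h₀⟩ j hj ↦ ?_⟩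
  obtain rfl | rfl | hj : j = 2 ∨ j = 0 ∨ (j < 0 ∨ 2 < j) := by lia
  · exact h₂
  · exact h₀
  · exact Φ.isZero_coh hdim E j hj

lemma isLE_of_isLE_boundedTStructure (X : DerivedCategory.Bounded Z) (n : ℤ)
    (hX : (boundedTStructure Z).IsLE X n) : Φ.tStructure.IsLE X (n + 2) := by
  obtain ⟨⟨a, ha⟩, -⟩ := bounded_boundedTStructure Z X
  refine isLE_of_heart_le _ _ 2 ?_ (n - a).toNat n X hX
    ((boundedTStructure Z).isGE_of_ge X _ a (by lia))
  rw [← essImage_boundedSingle]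
  rintro Y ⟨E, ⟨e⟩⟩
  have := Φ.isLE_single hdim E
  exact Φ.tStructure.isLE_of_iso e 2

lemma isGE_of_isGE_boundedTStructure (X : DerivedCategory.Bounded Z) (n : ℤ)
    (hX : (boundedTStructure Z).IsGE X n) : Φ.tStructure.IsGE X n := by
  obtain ⟨-, ⟨b, hb⟩⟩ := bounded_boundedTStructure Z X
  rw [← add_zero n]
  refine isGE_of_heart_le _ _ 0 ?_ (b - n).toNat n X hX
    ((boundedTStructure Z).isLE_of_le X b _ (by lia))
  rw [← essImage_boundedSingle]
  rintro Y ⟨E, ⟨e⟩⟩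
  have := Φ.isGE_single hdim E
  exact Φ.tStructure.isGE_of_iso e 0

/-- Orthogonal form of the inclusion of coaisles in degrees `≥ 1`. -/
lemma isLE_boundedTStructure_of_isLE (X : DerivedCategory.Bounded Z)
    (hX : Φ.tStructure.IsLE X 0) : (boundedTStructure Z).IsLE X 0 :=
  isLE_of_forall_isGE (a := 1) (b := 1)
    (fun Y hY ↦ Φ.isGE_of_isGE_boundedTStructure hdim Y 1 hY) X hX

/-- The kernel has `Φ`-degrees `≤ 2`, so no `Φ³` obstructs the surjectivity of `Φ²(G) ⟶ Φ²(Q)`. -/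
lemma B_two_isClosedUnderQuotients : (Φ.B 2).IsClosedUnderQuotients where
  prop_of_epi {G Q} f _ hG := by
    rw [Φ.B_two_iff hdim] at hG ⊢
    obtain ⟨δ, hT⟩ := exists_distTriang_of_shortExact
      (S := ShortComplex.mk (kernel.ι f) f (kernel.condition f))
      { exact := ShortComplex.exact_kernel f
        mono_f := inferInstanceAs (Mono (kernel.ι f))
        epi_g := ‹_› }
    exact isLE_right_of_distTriang hT _ 1 (Φ.isLE_single hdim _) hG

lemma B_two_isClosedUnderExtensions : (Φ.B 2).IsClosedUnderExtensions where
  prop_X₂_of_shortExact hS h₁ h₃ := by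
    rw [Φ.B_two_iff hdim] at h₁ h₃ ⊢
    obtain ⟨δ, hT⟩ := exists_distTriang_of_shortExact hS
    exact Φ.tStructure.isLE₂ _ hT 1 h₁ h₃

omit hdim in
lemma B_containsZero (i : ℤ) : (Φ.B i).ContainsZero where
  exists_zero := by
    obtain ⟨E, hE⟩ := HasZeroObject.zero (C := Z)
    have h₁ := Φ.equiv.functor.map_isZero ((boundedSingle Z).map_isZero hE)
    exact ⟨E, hE, (DerivedCategory.homologyFunctor _ i).map_isZero
      (DerivedCategory.Bounded.ι.map_isZero h₁)⟩

/-- Let `M ⟶ E` be the `Φ`-truncation to degrees `≤ 0`. As `M` lies in standard degrees `≤ 0`, the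
map factors through its standard `H⁰(M) = G`. Since `G` is in `ℬ₂`, the map is zero, hence `M = 0`.
-/
lemma B_zero_of_rightOrthogonal (E : Z) (hE : (Φ.B 2).rightOrthogonal E) : Φ.B 0 E := by
  let t := boundedTStructure Z
  let F := (boundedSingle Z).obj E
  let M := (Φ.tStructure.truncLT 1).obj F
  have hM : Φ.tStructure.IsLE M 0 := Φ.tStructure.isLE_truncLT_obj F 1 0
  have hM' : t.IsLE M 0 := Φ.isLE_boundedTStructure_of_isLE hdim M hM
  have hF : t.IsGE F 0 := ((t.mem_heart_iff F).1 (by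
    rw [← essImage_boundedSingle]
    exact (boundedSingle Z).obj_mem_essImage E)).2
  have hN : t.heart ((t.truncGE 0).obj M) :=
    (t.mem_heart_iff _).2 ⟨inferInstance, inferInstance⟩
  rw [← essImage_boundedSingle] at hN
  obtain ⟨G, ⟨e⟩⟩ := hN
  have hG : Φ.B 2 G := by
    rw [Φ.B_two_iff hdim]
    -- Standard degrees `≤ -1` give `Φ`-degrees `≤ 1`, so the cone `H⁰(M)` of the map to `M` has
    -- `Φ`-degrees `≤ 0`, more than `ℬ₂` requires.
    have h₁ : Φ.tStructure.IsLE ((t.truncLT 0).obj M) (0 + 1) :=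
      Φ.isLE_of_isLE_boundedTStructure hdim _ (-1) (t.isLE_truncLT_obj M 0 (-1))
    have := isLE_right_of_distTriang (distTriang_trunc t 0 M) Φ.tStructure 0 h₁ hM
    have := Φ.tStructure.isLE_of_iso e.symm 0
    exact Φ.tStructure.isLE_of_le _ 0 1
  have hι : (Φ.tStructure.truncLTι 1).app F = 0 := by
    let φ : M ⟶ F := (Φ.tStructure.truncLTι 1).app F
    have h₁ : t.descTruncGE φ 0 = 0 := by
      rw [← cancel_epi e.hom, comp_zero, ← (boundedSingle Z).map_preimage (e.hom ≫ _),
        hE ((boundedSingle Z).preimage _) hG, Functor.map_zero]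
    change φ = 0
    rw [← t.π_descTruncGE φ 0, h₁, comp_zero]
  rw [Φ.B_zero_iff hdim, Φ.tStructure.isGE_iff_isZero_truncLT_obj]
  exact isZero_left_of_eq_zero (distTriang_trunc Φ.tStructure 1 F) Φ.tStructure 0 hM
    (Φ.tStructure.isGE_truncGE_obj F 1 0) hι

lemma rightOrthogonal_B_two :
    (Φ.B 2).rightOrthogonal = Φ.B 0 ⊓ (Φ.X 1).rightOrthogonal := by
  ext E
  refine ⟨fun hE ↦ ⟨Φ.B_zero_of_rightOrthogonal hdim E hE,
    fun G f hG ↦ hE f ((Φ.X_one_iff hdim G).1 hG).1⟩, ?_⟩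
  rintro ⟨hE, hE'⟩ G f hG
  have := Φ.B_two_isClosedUnderQuotients hdim
  -- The image is a quotient of `G` and a subobject of `E`, so it lies in both `ℬ₂` and `ℬ₀`, that
  -- is, in `𝒳₁`.
  have h₂ : Φ.B 2 (image f) := (Φ.B 2).prop_of_epi (factorThruImage f) hG
  have h₀ : Φ.B 0 (image f) := by
    rw [Φ.B_zero_iff hdim] at hE ⊢
    obtain ⟨δ, hT⟩ := exists_distTriang_of_shortExact
      (S := ShortComplex.mk (image.ι f) (cokernel.π (image.ι f)) (cokernel.condition _))
      { exact := ShortComplex.exact_cokernel _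
        mono_f := inferInstanceAs (Mono (image.ι f))
        epi_g := inferInstanceAs (Epi (cokernel.π (image.ι f))) }
    exact isGE_left_of_distTriang hT _ 1 hE (Φ.isGE_single hdim _)
  rw [← image.fac f, hE' (image.ι f) ((Φ.X_one_iff hdim _).2 ⟨h₂, h₀⟩), comp_zero]

lemma isTorsionPair_B_two (hnoeth : IsNoetherianCategory Z) :
    IsTorsionPair (Φ.B 2) (Φ.B 0 ⊓ (Φ.X 1).rightOrthogonal) := by
  have := Φ.B_two_isClosedUnderQuotients hdim
  have := Φ.B_two_isClosedUnderExtensions hdim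
  have := Φ.B_containsZero 2
  rw [← Φ.rightOrthogonal_B_two hdim]
  exact isTorsionPair_rightOrthogonal hnoeth _

lemma isLE_of_map_B_two {X : DerivedCategory.Bounded Z}
    (hX : (Φ.B 2).map (boundedSingle Z) X) : Φ.tStructure.IsLE X 1 := by
  obtain ⟨E, hE, ⟨e⟩⟩ := hX
  rw [Φ.B_two_iff hdim] at hE
  exact Φ.tStructure.isLE_of_iso e 1

lemma isGE_of_map_B_zero {P : ObjectProperty Z} {X : DerivedCategory.Bounded Z}
    (hX : (Φ.B 0 ⊓ P).map (boundedSingle Z) X) : Φ.tStructure.IsGE X 1 := by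
  obtain ⟨E, hE, ⟨e⟩⟩ := hX
  have := (Φ.B_zero_iff hdim E).1 hE.1
  exact Φ.tStructure.isGE_of_iso e 1

end Amplitude

end TiltingEquivalence

end TiltingHearts

end

open TiltingHearts in
theorem proposition2 {Z : Type u} [Category.{v} Z] [Abelian Z]
    [HasExt.{w₀} Z] [HasDerivedCategory.{w₁} Z]
    (hnoeth : IsNoetherianCategory Z) (hdim : HasHomologicalDimension.{w₀} Z 2)
    (T : Z) [IsNoetherianRing (EndOp T)]
    [HasDerivedCategory.{w₂} (FGModuleCat.{v} (EndOp T))]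
    [HasDerivedCategory.{w₃} (ModuleCat.{v} (EndOp T))]
    (Φ : TiltingEquivalence.{w₀, w₁, w₂, w₃} T) :
    IsTorsionPair (Φ.B 2) (Φ.B 0 ⊓ (Φ.X 1).rightOrthogonal) ∧
    IsBoundedHeart Φ.U21 ∧ IsBoundedHeart Φ.H ∧
    IsTiltAt Φ.U21 (Φ.U21 ⊓ Φ.H) (Φ.U21 ⊓ Φ.H.shift (1 : ℤ)) Φ.H := by
  have hpair := Φ.isTorsionPair_B_two hdim hnoeth
  let t := boundedTStructure Z
  have htors := hpair.isHeartTorsionPair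
  let s := tiltTStructure htors
  have hs : s.heart = Φ.U21 := tiltTStructure_heart htors
  refine ⟨hpair, ⟨s, hs, fun X ↦ tiltTStructure_bounded htors X (bounded_boundedTStructure Z X)⟩,
    Φ.isBoundedHeart_H, ?_⟩
  rw [← hs, ← Φ.tStructure_heart]
  refine isTiltAt_of_isLE s Φ.tStructure (fun X hX ↦ ?_) (fun X hX ↦ ?_)
  -- `W` lies in the aisle of `s`: it is an extension of `H⁰(W)` in `ℬ₂` by an object of standard
  -- degrees `≤ -1`, and both have `Φ`-degrees `≤ 1`.
  · let W := X⟦(-1 : ℤ)⟧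
    have hW := (tiltTStructure_isLE_zero_iff htors W).1 (s.isLE_shift X (-1) (-1) 0)
    have h₁ : Φ.tStructure.IsLE ((t.truncLT 0).obj W) (-1 + 2) :=
      Φ.isLE_of_isLE_boundedTStructure hdim _ (-1) (t.isLE_truncLT_obj W 0 (-1))
    have h₂ := Φ.isLE_of_map_B_two hdim (htors.truncGE_of_tiltLE hW)
    have : Φ.tStructure.IsLE W 1 := Φ.tStructure.isLE₂ _ (distTriang_trunc t 0 W) 1 h₁ h₂
    exact Φ.tStructure.isLE_of_shift X 0 (-1) 1
  · rw [tiltTStructure_isLE_zero_iff]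
    refine ⟨(Φ.isLE_boundedTStructure_of_isLE hdim X hX).le, fun Y f hY ↦ ?_⟩
    have := Φ.isGE_of_map_B_zero hdim hY
    exact Φ.tStructure.zero f 0 1
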